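/- Let $R$ be a commutative LG-ring, i.e., for every $n\in\mathbb N$, every polynomial $f\in R[X_1,\dots,X_n]$ that takes a unit value over $R/\mathfrak m$ for each maximal ideal $\mathfrak m$ of $R$ takes a unit value over $R$. Let $S$ be a quadratic étale $R$-algebra, i.e., a commutative étale $R$-algebra whose underlying $R$-module is finitely generated projective of constant rank $2$, and let $\sigma$ be its standard involution, i.e., the unique $R$-linear involution of $S$ with $s\,\sigma(s)\in R\cdot 1_S$ for all $s\in S$ (if $S$ is free with basis $1,z$ and $z^2=az+b$ with $a,b\in R$, then $\sigma(z)=a-z$). A hermitian space over $(S,\sigma)$ is a finitely generated projective $S$-module $M$ together with a bi-additive map $h\colon M\times M\to S$ satisfying $h(ms,m's')=\sigma(s)\,h(m,m')\,s'$ and $h(m,m')=\sigma(h(m',m))$ for all $m,m'\in M$ and $s,s'\in S$, such that the map $M\to\operatorname{Hom}_S(M,S)$, $m\mapsto h(m,-)$, is bijective. Its orthogonal sum with a second hermitian space $(M',h')$ is $M\oplus M'$ with the form $(h\perp h')(m+m',n+n')=h(m,n)+h'(m',n')$. Two hermitian spaces are isometric, written $\cong$, if there is an $S$-linear bijection between the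 underlying modules that is compatible with the forms. Then cancellation holds for hermitian spaces: if $(M_1,h_1)$, $(M_2,h_2)$, $(M_3,h_3)$ are hermitian spaces over $(S,\sigma)$, then $$h_1\perp h_3\;\cong\;h_2\perp h_3\quad\Longrightarrow\quad h_1\cong h_2 .$$ -/

import Mathlib

/-- `R` is an LG-ring (local-global ring): a polynomial in finitely many variables over `R`
represents a unit over `R` as soon as it represents a unit over `R ⧸ m` for every maximal
ideal `m`. -/
def IsLGRing (R : Type*) [CommRing R] : Prop :=
  ∀ (n : ℕ) (f : MvPolynomial (Fin n) R),
    (∀ m : Ideal R, m.IsMaximal → ∃ x : Fin n → R ⧸ m, IsUnit (MvPolynomial.aeval x f)) →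
      ∃ x : Fin n → R, IsUnit (MvPolynomial.eval x f)

/-- A quadratic étale `R`-algebra: an étale `R`-algebra whose underlying module is finitely
generated projective of constant rank `2`. -/
structure IsQuadraticEtale (R S : Type*) [CommRing R] [CommRing S] [Algebra R S] : Prop where
  etale : Algebra.Etale R S
  finite : Module.Finite R S
  projective : Module.Projective R S
  rank_eq_two : ∀ p : PrimeSpectrum R, Module.rankAtStalk (R := R) S p = 2

/-- A standard involution of a commutative `R`-algebra `S`: an `R`-linear involution such that
all norms `s * σ s` (hence, replacing `s` by `1 + s`, also all traces `s + σ s`) lie in the image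
of `R`. On a quadratic `R`-algebra there is exactly one; if `1, z` is a basis of `S`
and `z * z = a z + b`, it is determined by `σ z = a - z`,
see `isStandardInvolution_iff_of_basis`. -/
structure IsStandardInvolution {R S : Type*} [CommRing R] [CommRing S] [Algebra R S]
    (σ : S ≃ₐ[R] S) : Prop where
  involutive : ∀ s : S, σ (σ s) = s
  norm_mem : ∀ s : S, ∃ r : R, s * σ s = algebraMap R S r

theorem isStandardInvolution_iff_of_basis {R S : Type*} [CommRing R] [CommRing S] [Algebra R S]
    (σ : S ≃ₐ[R] S) (e : Module.Basis (Fin 2) R S) (he : e 0 = 1) (a b : R)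
    (hz : e 1 * e 1 = algebraMap R S a * e 1 + algebraMap R S b) :
    IsStandardInvolution σ ↔ σ (e 1) = algebraMap R S a - e 1 := by
  constructor
  · intro h
    obtain ⟨n, hn⟩ := h.norm_mem (e 1)
    obtain ⟨n', hn'⟩ := h.norm_mem (1 + e 1)
    have hσ : σ (e 1) = algebraMap R S (n' - 1 - n) - e 1 := by
      rw [map_add σ, map_one σ] at hn'
      simp only [map_sub, map_one]
      linear_combination hn' - hn
    have hlin : (n' - 1 - n - a) • e 1 + (-n - b) • e 0 = 0 := by
      rw [he]
      simp only [Algebra.smul_def, map_sub, map_neg, map_one, mul_one] at hσ ⊢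
      rw [hσ] at hn
      linear_combination hz + hn
    have h1 := congrArg (fun s => e.repr s 1) hlin
    simp at h1
    rw [hσ, sub_eq_zero.mp h1]
  · intro h
    have key : ∀ s : S, ∃ u v : R, s = algebraMap R S u + algebraMap R S v * e 1 := by
      intro s
      refine ⟨e.repr s 0, e.repr s 1, ?_⟩
      conv_lhs => rw [← e.sum_repr s]
      simp [Fin.sum_univ_two, he, Algebra.smul_def]
    constructor
    · intro s
      obtain ⟨u, v, rfl⟩ := key s
      simp [h]
    · intro s
      obtain ⟨u, v, rfl⟩ := key s
      refine ⟨u * u + u * v * a - v * v * b, ?_⟩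
      simp only [map_add, map_mul, AlgEquiv.commutes, h, map_sub]
      linear_combination -(algebraMap R S v * algebraMap R S v) * hz

section Hermitian

variable {R S : Type*} [CommRing R] [CommRing S] [Algebra R S] {σ : S ≃ₐ[R] S}

/-- `(S, σ)`-sesquilinear forms on `M`: `σ`-semilinear in the first variable and linear in the
second one. -/
abbrev SesqForm (σ : S ≃ₐ[R] S) (M : Type*) [AddCommGroup M] [Module S M] :=
  M →ₛₗ[((σ : S →+* S))] M →ₗ[S] S

variable {M M₁ M₂ : Type*} [AddCommGroup M] [Module S M] [AddCommGroup M₁] [Module S M₁]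
  [AddCommGroup M₂] [Module S M₂]

/-- `(M, h)` is an `(S, σ)`-hermitian space: `M` is finitely generated projective over `S`, `h` is
hermitian, and the adjoint `M → Hom_S(M, S)`, `m ↦ h(m, -)`, is bijective. -/
structure IsHermitianSpace (h : SesqForm σ M) : Prop where
  finite : Module.Finite S M
  projective : Module.Projective S M
  hermitian : ∀ m m' : M, h m m' = σ (h m' m)
  regular : Function.Bijective (fun m : M => h m)

/-- The orthogonal sum `h₁ ⊥ h₂` on `M₁ × M₂`. -/
def orthSum (h₁ : SesqForm σ M₁) (h₂ : SesqForm σ M₂) : SesqForm σ (M₁ × M₂) :=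
  LinearMap.mk₂'ₛₗ (σ : S →+* S) (RingHom.id S)
    (fun x y : M₁ × M₂ => h₁ x.1 y.1 + h₂ x.2 y.2)
    (fun x x' y => by simp; ring)
    (fun c x y => by simp; ring)
    (fun x y y' => by simp; ring)
    (fun c x y => by simp; ring)

/-- Two sesquilinear forms are isometric if there is an `S`-linear bijection transforming one into
the other. -/
def IsIsometric (h₁ : SesqForm σ M₁) (h₂ : SesqForm σ M₂) : Prop :=
  ∃ f : M₁ ≃ₗ[S] M₂, ∀ m m' : M₁, h₂ (f m) (f m') = h₁ m m'

end Hermitian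

/-!
Cancellation is first reduced to hyperbolic planes. As `S` is étale, there is `t` in `S` with
`t + σ t = 1`, so every hermitian space `M₃` embeds isometrically into a hyperbolic space on
`Sⁿ × Sⁿ`, where it has an orthogonal complement `K`
(`IsHermitianSpace.exists_orthSum_hyperbolic`). Adding `K` on both sides, it suffices to show that
in a finitely generated `V` the complements of two hyperbolic families are isometric, and by
induction that the complements of two hyperbolic pairs `(e, f)` and `(e', f')` are
(`IsHyperbolicPair.isIsometric_compl`).

The complement of a hyperbolic pair `(e, f)` is `eᗮ / S e`, so only `e` matters, and the point is to
find an isometry of `V` taking `e` to `e'` (`IsHyperbolicPair.exists_isometry`). Two isotropic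
vectors `x`, `y` with `h x y` a unit are carried to each other by a quasi-reflection
(`exists_isometry_apply_eq`), so an isotropic vector `z` is wanted such that `h e z` and `h z e'`
are units. Candidates are `z = f + w - q • e`, where `w` is orthogonal to `e` and `f`, and
`q = t * h w w + s - σ s`: they are isotropic and `h e z = 1`. Moreover, `h z e'` is a polynomial in
coordinates of `w` and `s` over `R`. The LG-property, applied to the norm of this polynomial
(`IsLGRing.exists_isUnit_eval`), leaves the problem of making `h z e'` a unit modulo each maximal
ideal of `R`. This is done in `exists_isotropicValue_notMem`, by cases according to the vanishing of
`h e e'` at the one or two maximal ideals of `S` above; the cases work for all residue fields,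
including `𝔽₂`. What is needed there from étaleness is that `σ` acts nontrivially modulo every
maximal ideal of `S` (`IsQuadraticEtale.exists_sub_notMem`).
-/

/-! ### Quadratic étale algebras -/

section QuadraticEtale

open TensorProduct

variable {R S : Type*} [CommRing R] [CommRing S] [Algebra R S] {σ : S ≃ₐ[R] S}

theorem IsStandardInvolution.trace_mem (hσ : IsStandardInvolution σ) (s : S) :
    ∃ r : R, s + σ s = algebraMap R S r := by
  obtain ⟨n, hn⟩ := hσ.norm_mem s
  obtain ⟨n', hn'⟩ := hσ.norm_mem (1 + s)
  refine ⟨n' - 1 - n, ?_⟩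
  simp only [map_add, map_one] at hn'
  simp only [map_sub, map_one]
  linear_combination hn' - hn

theorem IsQuadraticEtale.algebraMap_injective (hS : IsQuadraticEtale R S) :
    Function.Injective (algebraMap R S) := by
  have := hS.finite
  have := hS.projective
  exact Module.rankAtStalk_pos_iff_algebraMap_injective.mp fun p => by
    rw [hS.rank_eq_two p]; norm_num

theorem IsQuadraticEtale.exists_maximal_comap_eq (hS : IsQuadraticEtale R S) (m : Ideal R)
    [m.IsMaximal] : ∃ n : Ideal S, n.IsMaximal ∧ n.comap (algebraMap R S) = m := by
  have := hS.finite
  refine Ideal.exists_ideal_over_maximal_of_isIntegral m ?_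
  rw [(RingHom.injective_iff_ker_eq_bot _).mp hS.algebraMap_injective]
  exact bot_le

theorem IsQuadraticEtale.finrank_residue (hS : IsQuadraticEtale R S) (k : Type*) [Field k]
    [Algebra R k] : Module.finrank k (k ⊗[R] S) = 2 := by
  have := hS.finite
  have := hS.projective
  have h := Module.rankAtStalk_baseChange (R := R) (M := S) (S := k) ⊥
  rw [hS.rank_eq_two, Module.rankAtStalk_eq_finrank_of_free] at h
  simpa using h

/-- A nonzero unramified algebra over a field `k` in which all `x ^ 2` and `2 * x` are scalars is
`k` itself: it is a field, and it is purely inseparable over `k` in characteristic `2`. -/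
theorem surjective_algebraMap_of_sq_mem_of_two_mul_mem {k : Type*} {A : Type*} [Field k]
    [CommRing A] [Nontrivial A] [Algebra k A] [Algebra.FormallyUnramified k A]
    [Module.Finite k A]
    (hsq : ∀ x : A, ∃ r : k, x ^ 2 = algebraMap k A r)
    (htwo : ∀ x : A, ∃ r : k, 2 * x = algebraMap k A r) :
    Function.Surjective (algebraMap k A) := by
  have hred : IsReduced A := Algebra.FormallyUnramified.isReduced_of_field k A
  have hA : IsField A := by
    refine ⟨⟨0, 1, zero_ne_one⟩, mul_comm, fun {x} hx => ?_⟩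
    obtain ⟨r, hr⟩ := hsq x
    have hr0 : r ≠ 0 := by
      rintro rfl
      exact hx (pow_eq_zero_iff two_ne_zero |>.mp (by simpa using hr))
    refine ⟨x * algebraMap k A r⁻¹, ?_⟩
    rw [← mul_assoc, ← sq, hr, ← map_mul, mul_inv_cancel₀ hr0, map_one]
  let : Field A := hA.toField
  by_cases h2 : (2 : k) = 0
  · have : CharP k 2 := CharTwo.of_one_ne_zero_of_two_eq_zero one_ne_zero h2
    have : ExpChar k 2 := ExpChar.prime Nat.prime_two
    have : IsPurelyInseparable k A := by
      rw [isPurelyInseparable_iff_pow_mem k (q := 2)]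
      intro x
      obtain ⟨r, hr⟩ := hsq x
      exact ⟨1, r, by simpa using hr.symm⟩
    exact RingHom.range_eq_top.mp
      (Algebra.FormallyUnramified.range_eq_top_of_isPurelyInseparable k A)
  · intro x
    obtain ⟨r, hr⟩ := htwo x
    refine ⟨2⁻¹ * r, ?_⟩
    rw [map_mul, ← hr, ← mul_assoc, ← map_ofNat (algebraMap k A) 2, ← map_mul,
      inv_mul_cancel₀ h2, map_one, one_mul]

/-- The standard involution of a quadratic étale algebra acts nontrivially modulo every maximal
ideal. Otherwise it would be trivial on the reduced fibre `A` of `S`, since the square of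
`s - σ s` is a scalar; then squares and doubles of elements of `A` are scalars, which leaves
only rank `1`. -/
theorem IsQuadraticEtale.exists_sub_notMem (hS : IsQuadraticEtale R S)
    (hσ : IsStandardInvolution σ) (n : Ideal S) [n.IsMaximal] : ∃ s : S, s - σ s ∉ n := by
  by_contra! hcon
  have := hS.finite
  have := hS.etale
  have : Algebra.FormallyUnramified R S := inferInstance
  let m : Ideal R := n.comap (algebraMap R S)
  have hm : m.IsMaximal := Ideal.isMaximal_comap_of_isIntegral_of_isMaximal n
  let : Field (R ⧸ m) := Ideal.Quotient.field m
  let A := (R ⧸ m) ⊗[R] S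
  let q : S →ₐ[R] A := Algebra.TensorProduct.includeRight
  have hrank : Module.finrank (R ⧸ m) A = 2 := hS.finrank_residue (R ⧸ m)
  have : Nontrivial A := Module.nontrivial_of_finrank_pos (R := R ⧸ m) (by omega)
  have hred : IsReduced A := Algebra.FormallyUnramified.isReduced_of_field (R ⧸ m) A
  have hqm : ∀ r : R, q (algebraMap R S r) = algebraMap (R ⧸ m) A (Ideal.Quotient.mk m r) := by
    intro r
    rw [AlgHom.commutes]
    rfl
  have hq : Function.Surjective q := by
    intro x
    induction x using TensorProduct.induction_on with
    | zero => exact ⟨0, map_zero _⟩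
    | add x y hx hy =>
      obtain ⟨s, rfl⟩ := hx
      obtain ⟨t, rfl⟩ := hy
      exact ⟨s + t, map_add _ _ _⟩
    | tmul c s =>
      obtain ⟨r, rfl⟩ := Ideal.Quotient.mk_surjective c
      refine ⟨r • s, ?_⟩
      change (1 : R ⧸ m) ⊗ₜ[R] (r • s) = _
      rw [← TensorProduct.smul_tmul, Algebra.smul_def, mul_one]
      rfl
  have hfix : ∀ s : S, q (σ s) = q s := by
    intro s
    obtain ⟨u, hu⟩ := hσ.trace_mem s
    obtain ⟨v, hv⟩ := hσ.norm_mem s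
    have hd : (s - σ s) ^ 2 = algebraMap R S (u ^ 2 - 4 * v) := by
      simp only [map_sub, map_mul, map_pow, map_ofNat, ← hu, ← hv]
      ring
    have hdm : u ^ 2 - 4 * v ∈ m := by
      change algebraMap R S _ ∈ n
      rw [← hd]
      exact Ideal.pow_mem_of_mem n (hcon s) 2 two_pos
    have h0 : q (s - σ s) ^ 2 = 0 := by
      rw [← map_pow, hd, hqm, Ideal.Quotient.eq_zero_iff_mem.mpr hdm, map_zero]
    have := pow_eq_zero_iff two_ne_zero |>.mp h0
    rw [map_sub, sub_eq_zero] at this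
    exact this.symm
  have hsurj : Function.Surjective (algebraMap (R ⧸ m) A) := by
    refine surjective_algebraMap_of_sq_mem_of_two_mul_mem (fun x => ?_) (fun x => ?_)
    · obtain ⟨s, rfl⟩ := hq x
      obtain ⟨v, hv⟩ := hσ.norm_mem s
      exact ⟨_, by rw [← hqm, ← hv, map_mul, hfix, sq]⟩
    · obtain ⟨s, rfl⟩ := hq x
      obtain ⟨u, hu⟩ := hσ.trace_mem s
      exact ⟨_, by rw [← hqm, ← hu, map_add, hfix, two_mul]⟩
  have h1 : Module.finrank (R ⧸ m) A ≤ 1 := by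
    refine finrank_le_one (1 : A) fun w => ?_
    obtain ⟨c, hc⟩ := hsurj w
    exact ⟨c, by rw [← hc, Algebra.algebraMap_eq_smul_one]⟩
  omega

theorem IsQuadraticEtale.exists_trace_eq_one (hS : IsQuadraticEtale R S)
    (hσ : IsStandardInvolution σ) : ∃ t : S, t + σ t = 1 := by
  let I : Ideal R :=
    { carrier := {r | ∃ s : S, s + σ s = algebraMap R S r}
      zero_mem' := ⟨0, by simp⟩
      add_mem' := by
        rintro _ _ ⟨s, hs⟩ ⟨t, ht⟩
        exact ⟨s + t, by rw [map_add, map_add, ← hs, ← ht]; ring⟩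
      smul_mem' := by
        rintro c r ⟨s, hs⟩
        exact ⟨algebraMap R S c * s, by
          rw [map_mul, AlgEquiv.commutes, smul_eq_mul, map_mul, ← hs]; ring⟩ }
  by_cases hI : I = ⊤
  · obtain ⟨t, ht⟩ : (1 : R) ∈ I := hI ▸ Submodule.mem_top
    exact ⟨t, by rw [ht, map_one]⟩
  · obtain ⟨m, hm, hIm⟩ := Ideal.exists_le_maximal I hI
    obtain ⟨n, hn, rfl⟩ := hS.exists_maximal_comap_eq m
    have htr : ∀ s : S, s + σ s ∈ n := fun s => by
      obtain ⟨r, hr⟩ := hσ.trace_mem s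
      rw [hr]
      exact hIm ⟨s, hr⟩
    obtain ⟨s, hs⟩ := hS.exists_sub_notMem hσ n
    have h2 : (2 : S) ∈ n := by
      have := htr 1
      rwa [map_one, one_add_one_eq_two] at this
    refine absurd ?_ hs
    have : s - σ s = (s + σ s) - σ s * 2 := by ring
    rw [this]
    exact n.sub_mem (htr s) (n.mul_mem_left _ h2)

theorem IsQuadraticEtale.mem_range_of_fixed (hS : IsQuadraticEtale R S)
    (hσ : IsStandardInvolution σ) {s : S} (hs : σ s = s) : ∃ r : R, algebraMap R S r = s := by
  obtain ⟨t, ht⟩ := hS.exists_trace_eq_one hσ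
  obtain ⟨r, hr⟩ := hσ.trace_mem (s * t)
  refine ⟨r, ?_⟩
  rw [← hr, map_mul, hs, ← mul_add, ht, mul_one]

/-- The local-global principle for polynomial functions with values in a quadratic étale algebra:
if `F` takes a unit value at the points of `Spec S` above each maximal ideal of `R`, then `F` takes
a unit value. The maximal ideals above `m = n ∩ R` are `n` and `σ n`. The proof applies the
LG-property to the norm `F * σ F`, whose coefficients are fixed by `σ` and hence lie in `R`. -/
theorem IsLGRing.exists_isUnit_eval (hR : IsLGRing R) (hS : IsQuadraticEtale R S)
    (hσ : IsStandardInvolution σ) {ι : Type*} [Finite ι] (F : MvPolynomial ι S)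
    (hF : ∀ n : Ideal S, n.IsMaximal → ∃ x : ι → R,
      MvPolynomial.eval (fun i => algebraMap R S (x i)) F ∉ n ∧
      σ (MvPolynomial.eval (fun i => algebraMap R S (x i)) F) ∉ n) :
    ∃ x : ι → R, IsUnit (MvPolynomial.eval (fun i => algebraMap R S (x i)) F) := by
  have hσ' : ∀ x : ι → R, MvPolynomial.eval (fun i => algebraMap R S (x i))
      (MvPolynomial.map (σ : S →+* S) F) =
        σ (MvPolynomial.eval (fun i => algebraMap R S (x i)) F) := by
    intro x
    rw [MvPolynomial.eval_map]
    change _ = (σ : S →+* S) _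
    rw [← MvPolynomial.eval₂_id, MvPolynomial.hom_eval₂]
    simp
  obtain ⟨G, hG⟩ : F * MvPolynomial.map (σ : S →+* S) F ∈
      Set.range (MvPolynomial.map (algebraMap R S)) := by
    rw [MvPolynomial.mem_range_map_iff_coeffs_subset]
    intro c hc
    obtain ⟨d, -, rfl⟩ := MvPolynomial.mem_coeffs_iff.mp (Finset.mem_coe.mp hc)
    refine hS.mem_range_of_fixed hσ ?_
    change (σ : S →+* S) _ = _
    rw [← MvPolynomial.coeff_map, map_mul, MvPolynomial.map_map]
    have : (σ : S →+* S).comp (σ : S →+* S) = RingHom.id S :=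
      RingHom.ext fun s => hσ.involutive s
    rw [this, MvPolynomial.map_id, mul_comm]
  have hGe : ∀ x : ι → R, algebraMap R S (MvPolynomial.eval x G) =
      MvPolynomial.eval (fun i => algebraMap R S (x i)) F *
        σ (MvPolynomial.eval (fun i => algebraMap R S (x i)) F) := by
    intro x
    rw [← hσ', ← map_mul, ← hG, MvPolynomial.eval_map, ← MvPolynomial.eval₂_id,
      MvPolynomial.hom_eval₂]
    simp
  obtain ⟨N, ⟨e⟩⟩ := Finite.exists_equiv_fin ι
  obtain ⟨x, hx⟩ := hR N (MvPolynomial.rename e G) fun m hm => by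
    obtain ⟨n, hn, rfl⟩ := hS.exists_maximal_comap_eq m
    obtain ⟨x, hx1, hx2⟩ := hF n hn
    set m := n.comap (algebraMap R S)
    refine ⟨fun i => Ideal.Quotient.mk m (x (e.symm i)), ?_⟩
    have hval : MvPolynomial.aeval (fun i => Ideal.Quotient.mk m (x (e.symm i)))
        (MvPolynomial.rename e G) = Ideal.Quotient.mk m (MvPolynomial.eval x G) := by
      rw [MvPolynomial.aeval_rename, ← MvPolynomial.eval₂_id, MvPolynomial.hom_eval₂]
      simp [Function.comp_def, MvPolynomial.aeval_def]
    rw [hval]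
    let : Field (R ⧸ m) := Ideal.Quotient.field m
    rw [isUnit_iff_ne_zero, Ne, Ideal.Quotient.eq_zero_iff_mem]
    intro h
    change algebraMap R S _ ∈ n at h
    rw [hGe] at h
    exact (hn.isPrime.mem_or_mem h).elim hx1 hx2
  refine ⟨x ∘ e, ?_⟩
  rw [MvPolynomial.eval_rename] at hx
  have := hx.map (algebraMap R S)
  rw [hGe] at this
  exact isUnit_of_mul_isUnit_left this

end QuadraticEtale

/-! ### Isometries and quasi-reflections -/

section Isometries

variable {R S : Type*} [CommRing R] [CommRing S] [Algebra R S] {σ : S ≃ₐ[R] S}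
  {V V₁ V₂ V₃ : Type*} [AddCommGroup V] [Module S V] [AddCommGroup V₁] [Module S V₁]
  [AddCommGroup V₂] [Module S V₂] [AddCommGroup V₃] [Module S V₃]

theorem IsIsometric.symm {h₁ : SesqForm σ V₁} {h₂ : SesqForm σ V₂} (H : IsIsometric h₁ h₂) :
    IsIsometric h₂ h₁ := by
  obtain ⟨g, hg⟩ := H
  exact ⟨g.symm, fun x y => by rw [← hg, g.apply_symm_apply, g.apply_symm_apply]⟩

theorem IsIsometric.trans {h₁ : SesqForm σ V₁} {h₂ : SesqForm σ V₂} {h₃ : SesqForm σ V₃}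
    (H : IsIsometric h₁ h₂) (H' : IsIsometric h₂ h₃) : IsIsometric h₁ h₃ := by
  obtain ⟨g, hg⟩ := H
  obtain ⟨g', hg'⟩ := H'
  exact ⟨g.trans g', fun x y => by simp [hg, hg']⟩

@[simp]
theorem orthSum_apply (h₁ : SesqForm σ V₁) (h₂ : SesqForm σ V₂) (x y : V₁ × V₂) :
    orthSum h₁ h₂ x y = h₁ x.1 y.1 + h₂ x.2 y.2 := rfl

theorem orthSum_hermitian {h₁ : SesqForm σ V₁} {h₂ : SesqForm σ V₂}
    (hh₁ : ∀ x y, h₁ x y = σ (h₁ y x)) (hh₂ : ∀ x y, h₂ x y = σ (h₂ y x)) (x y : V₁ × V₂) :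
    orthSum h₁ h₂ x y = σ (orthSum h₁ h₂ y x) := by
  rw [orthSum_apply, orthSum_apply, map_add, ← hh₁, ← hh₂]

/-- The restriction of a sesquilinear form to a submodule. -/
def restrictForm (h : SesqForm σ V) (K : Submodule S V) : SesqForm σ K :=
  LinearMap.mk₂'ₛₗ (σ : S →+* S) (RingHom.id S) (fun x y : K => h x y)
    (fun x x' y => by simp) (fun c x y => by simp) (fun x y y' => by simp) (fun c x y => by simp)

@[simp]
theorem restrictForm_apply (h : SesqForm σ V) (K : Submodule S V) (x y : K) :
    restrictForm h K x y = h x y := rfl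

theorem isIsometric_restrictForm {h₁ : SesqForm σ V₁} {h₂ : SesqForm σ V₂}
    {K₁ : Submodule S V₁} {K₂ : Submodule S V₂} (F : V₁ →ₗ[S] V₂) (G : V₂ →ₗ[S] V₁)
    (hF : ∀ x ∈ K₁, F x ∈ K₂) (hG : ∀ y ∈ K₂, G y ∈ K₁)
    (hGF : ∀ x ∈ K₁, G (F x) = x) (hFG : ∀ y ∈ K₂, F (G y) = y)
    (hh : ∀ x ∈ K₁, ∀ y ∈ K₁, h₂ (F x) (F y) = h₁ x y) :
    IsIsometric (restrictForm h₁ K₁) (restrictForm h₂ K₂) :=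
  ⟨LinearEquiv.ofLinearMap (F.restrict hF) (G.restrict hG)
    (LinearMap.ext fun y => Subtype.ext (hFG y y.2))
    (LinearMap.ext fun x => Subtype.ext (hGF x x.2)),
    fun x y => hh x x.2 y y.2⟩

theorem isIsometric_restrictForm_of_isometry {h₁ : SesqForm σ V₁} {h₂ : SesqForm σ V₂}
    (g : V₁ ≃ₗ[S] V₂) (hg : ∀ u v, h₂ (g u) (g v) = h₁ u v) {K₁ : Submodule S V₁}
    {K₂ : Submodule S V₂} (hK : ∀ x, x ∈ K₁ ↔ g x ∈ K₂) :
    IsIsometric (restrictForm h₁ K₁) (restrictForm h₂ K₂) :=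
  isIsometric_restrictForm (g : V₁ →ₗ[S] V₂) (g.symm : V₂ →ₗ[S] V₁) (fun x => (hK x).mp)
    (fun y hy => (hK _).mpr (by simpa using hy)) (by simp) (by simp) (by simp [hg])

/-- If `h x x = h y y` and `c = h (x - y) x` is a unit, the quasi-reflection
`v ↦ v - c⁻¹ h (x - y) v • (x - y)` is an isometry taking `x` to `y`. It is an isometry because
`c + σ c = h (x - y) (x - y)`, and its inverse is obtained by replacing `c` by `σ c`. -/
theorem exists_isometry_apply_eq {h : SesqForm σ V}
    (hh : ∀ x y, h x y = σ (h y x)) {x y : V} (hxy : h x x = h y y)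
    (hu : IsUnit (h (x - y) x)) :
    ∃ g : V ≃ₗ[S] V, (∀ u v, h (g u) (g v) = h u v) ∧ g x = y := by
  obtain ⟨d, hd⟩ := hu.exists_right_inv
  set w := x - y with hw
  set c := h w x with hc
  have hσd : σ c * σ d = 1 := by rw [← map_mul, hd, map_one]
  have htr : c + σ c = h w w := by
    rw [hc, ← hh x w, hw]
    simp only [map_sub, LinearMap.sub_apply]
    linear_combination hxy
  have hdd : d + σ d = d * σ d * h w w := by
    rw [← htr]
    linear_combination -σ d * hd - d * hσd
  let T : S → V →ₗ[S] V := fun a => LinearMap.id - a • (h w).smulRight w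
  have hT : ∀ a v, T a v = v - (a * h w v) • w := fun a v => by simp [T, mul_smul]
  have hcomp : ∀ a b, a + b = a * b * h w w → T a ∘ₗ T b = LinearMap.id := by
    intro a b hab
    ext v
    simp only [LinearMap.comp_apply, hT, map_sub, map_smul, smul_eq_mul, LinearMap.id_apply]
    have : a * (h w v - b * h w v * h w w) = -(b * h w v) := by
      linear_combination h w v * hab
    rw [this, neg_smul]
    abel
  refine ⟨LinearEquiv.ofLinearMap (T d) (T (σ d)) (hcomp _ _ hdd) (hcomp _ _ ?_), ?_, ?_⟩
  · rw [add_comm, hdd, mul_comm d]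
  · intro u v
    simp only [LinearEquiv.coe_ofLinearMap, hT, map_sub, map_smulₛₗ, LinearMap.sub_apply,
      LinearMap.smul_apply, smul_eq_mul, RingHom.id_apply, RingHom.coe_coe, map_mul]
    rw [← hh u w]
    linear_combination -h u w * h w v * hdd
  · rw [LinearEquiv.coe_ofLinearMap, hT, ← hc, mul_comm d, hd, one_smul, hw, sub_sub_cancel]

/-- A hyperbolic pair of a hermitian form: a basis of a hyperbolic plane. -/
structure IsHyperbolicPair (h : SesqForm σ V) (e f : V) : Prop where
  left_self : h e e = 0
  right_self : h f f = 0
  left_right : h e f = 1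
  right_left : h f e = 1

/-- The orthogonal complement of two vectors. -/
def pairCompl (h : SesqForm σ V) (e f : V) : Submodule S V :=
  LinearMap.ker (h e) ⊓ LinearMap.ker (h f)

theorem mem_pairCompl {h : SesqForm σ V} {e f v : V} :
    v ∈ pairCompl h e f ↔ h e v = 0 ∧ h f v = 0 := by
  simp [pairCompl]

/-- The complement of a hyperbolic pair `(e, f)` is determined by `e`, namely as `eᗮ / S e`. -/
theorem IsHyperbolicPair.isIsometric_compl_of_left {h : SesqForm σ V}
    (hh : ∀ x y, h x y = σ (h y x)) {e f f' : V} (hp : IsHyperbolicPair h e f)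
    (hp' : IsHyperbolicPair h e f') :
    IsIsometric (restrictForm h (pairCompl h e f)) (restrictForm h (pairCompl h e f')) := by
  have hsymm : ∀ x, h e x = 0 → h x e = 0 := fun x hx => by rw [hh, hx, map_zero]
  refine isIsometric_restrictForm (LinearMap.id - (h f').smulRight e)
    (LinearMap.id - (h f).smulRight e) ?_ ?_ ?_ ?_ ?_
  · intro x hx
    simp [mem_pairCompl, hp'.left_self, hp'.right_left, (mem_pairCompl.mp hx).1]
  · intro x hx
    simp [mem_pairCompl, hp.left_self, hp.right_left, (mem_pairCompl.mp hx).1]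
  · intro x hx
    simp [hp.right_left, (mem_pairCompl.mp hx).2]
  · intro x hx
    simp [hp'.right_left, (mem_pairCompl.mp hx).2]
  · intro x hx y hy
    simp [hp.left_self, hsymm x (mem_pairCompl.mp hx).1, (mem_pairCompl.mp hy).1]

end Isometries

/-! ### Isotropic vectors modulo a maximal ideal -/

section Transitivity

variable {R S : Type*} [CommRing R] [CommRing S] [Algebra R S] {σ : S ≃ₐ[R] S}
  {V : Type*} [AddCommGroup V] [Module S V]

/-- A quasi-inverse of `a`, in the sense of von Neumann regularity, modulo both `n` and `σ n`. -/
theorem exists_quasi_inverse (hσ : ∀ s : S, σ (σ s) = s) (n : Ideal S) [n.IsMaximal] (a : S) :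
    ∃ x : S, a * (1 - a * x) ∈ n ∧ σ (a * (1 - a * x)) ∈ n := by
  have key : ∀ a : S, ∃ x : S, a * (1 - a * x) ∈ n := by
    intro a
    by_cases ha : a ∈ n
    · exact ⟨0, n.mul_mem_right _ ha⟩
    · obtain ⟨x, i, hi, hx⟩ := Ideal.IsMaximal.exists_inv ‹_› ha
      refine ⟨x, n.mul_mem_left _ ?_⟩
      rwa [show 1 - a * x = i by linear_combination -hx]
  obtain ⟨x, hx⟩ := key a
  obtain ⟨y, hy⟩ := key (σ a)
  -- `1 - a * z` is the product of `1 - a * x` and `1 - a * σ y`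
  refine ⟨x + σ y - a * x * σ y, ?_, ?_⟩
  · rw [show a * (1 - a * (x + σ y - a * x * σ y)) = (a * (1 - a * x)) * (1 - a * σ y) by ring]
    exact n.mul_mem_right _ hx
  · rw [show a * (1 - a * (x + σ y - a * x * σ y)) = (1 - a * x) * (a * (1 - a * σ y)) by ring,
      map_mul]
    refine n.mul_mem_left _ ?_
    simpa [hσ] using hy

/-- The projection onto the complement of the hyperbolic pair `(e, f)`. -/
def pairProj (h : SesqForm σ V) (e f : V) : V →ₗ[S] V :=
  LinearMap.id - (h f).smulRight e - (h e).smulRight f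

theorem pairProj_apply (h : SesqForm σ V) (e f v : V) :
    pairProj h e f v = v - h f v • e - h e v • f := by simp [pairProj]

theorem pairProj_left (h : SesqForm σ V) (e f v u : V) :
    h (pairProj h e f v) u = h v u - σ (h f v) * h e u - σ (h e v) * h f u := by
  simp [pairProj_apply]

theorem IsHyperbolicPair.left_pairProj {h : SesqForm σ V} {e f : V} (hp : IsHyperbolicPair h e f)
    (v : V) : h e (pairProj h e f v) = 0 := by
  simp [pairProj_apply, hp.left_self, hp.left_right]

theorem IsHyperbolicPair.right_pairProj {h : SesqForm σ V} {e f : V} (hp : IsHyperbolicPair h e f)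
    (v : V) : h f (pairProj h e f v) = 0 := by
  simp [pairProj_apply, hp.right_self, hp.right_left]

theorem IsHyperbolicPair.pairProj_self {h : SesqForm σ V} (hh : ∀ x y, h x y = σ (h y x))
    {e f : V} (hp : IsHyperbolicPair h e f) (v : V) :
    h (pairProj h e f v) (pairProj h e f v) =
      h v v - σ (h f v) * h e v - σ (h e v) * h f v := by
  rw [pairProj_left, hp.left_pairProj, hp.right_pairProj, hh v, pairProj_left]
  simp only [map_sub, map_mul, ← hh]
  rw [hh v e, hh v f]
  ring

/-- The value `h z e'` for the isotropic vector `z = f + w - q • e`, where `w` is the projection of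
`v` to the complement of `(e, f)` and `q = t * h w w + s - σ s`. -/
def isotropicValue (h : SesqForm σ V) (t : S) (e f e' v : V) (s : S) : S :=
  h f e' + h (pairProj h e f v) e' -
    (σ t * h (pairProj h e f v) (pairProj h e f v) + σ s - s) * h e e'

section Local

variable {h : SesqForm σ V} {e f e' f' : V} {t : S}

/-- If `x` is an inverse of `h e e'` modulo `I` and `σ I`, then `v` and `s` are chosen so that `z` is
congruent to `x • e' - (s₀ - σ s₀) • e`, which gives `h z e' ≡ (s₀ - σ s₀) * h e e'`. -/
theorem isotropicValue_sub_mem (hσ : ∀ s : S, σ (σ s) = s) (hh : ∀ x y, h x y = σ (h y x))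
    (hp : IsHyperbolicPair h e f) (he' : h e' e' = 0) (ht : t + σ t = 1) (s₀ x : S) (I : Ideal S)
    (hx : 1 - h e e' * x ∈ I) (hσx : σ (1 - h e e' * x) ∈ I) :
    isotropicValue h t e f e' (x • e') (σ t * (-(h f e') * x + t * x * σ x *
      (h f e' * σ (h e e') + σ (h f e') * h e e')) + s₀) - (s₀ - σ s₀) * h e e' ∈ I := by
  rw [isotropicValue, hp.pairProj_self hh, pairProj_left]
  simp only [map_add, map_mul, map_neg, map_sub, map_one, hσ, map_smulₛₗ, LinearMap.smul_apply,
    smul_eq_mul, RingHom.id_apply, RingHom.coe_coe, he'] at hσx ⊢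
  rw [← Ideal.Quotient.eq_zero_iff_mem] at hx hσx ⊢
  have ht' := congrArg (Ideal.Quotient.mk I) ht
  simp only [map_sub, map_mul, map_add, map_neg, map_one, map_zero] at hx hσx ht' ⊢
  generalize Ideal.Quotient.mk I x = X at *
  generalize Ideal.Quotient.mk I (σ x) = X' at *
  generalize Ideal.Quotient.mk I (h e e') = B at *
  generalize Ideal.Quotient.mk I (σ (h e e')) = B' at *
  generalize Ideal.Quotient.mk I (h f e') = A at *
  generalize Ideal.Quotient.mk I (σ (h f e')) = A' at *
  generalize Ideal.Quotient.mk I t = T at *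
  generalize Ideal.Quotient.mk I (σ t) = T' at *
  generalize Ideal.Quotient.mk I s₀ = s at *
  generalize Ideal.Quotient.mk I (σ s₀) = s' at *
  grind

/-- The case where `h e e'` vanishes at all maximal ideals in question. With `x` a quasi-inverse of
`a = h f e'`, the value is congruent to `a + (1 - a * x)`, a unit; as `x` and `μ` do not depend on
`I`, this applies to two ideals at once. -/
theorem isotropicValue_notMem (hfe : h f' e' = 1) (I : Ideal S)
    [I.IsPrime] (hb : h e e' ∈ I) (x μ : S) (hμ : σ μ = 1 - h f e' * x)
    (hx : h f e' * (1 - h f e' * x) ∈ I) :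
    isotropicValue h t e f e' (μ • f') 0 ∉ I := by
  intro hc
  have h1 : h f e' + (1 - h f e' * x) ∈ I := by
    have hval : isotropicValue h t e f e' (μ • f') 0 = h f e' + (1 - h f e' * x)
        - σ (h e f') * (h f e' * (1 - h f e' * x))
        - ((1 - h f e' * x) * σ (h f f') + σ t * h (pairProj h e f (μ • f'))
            (pairProj h e f (μ • f'))) * h e e' := by
      rw [isotropicValue, pairProj_left]
      simp only [map_mul, map_smulₛₗ, LinearMap.smul_apply, smul_eq_mul, RingHom.id_apply,
        RingHom.coe_coe, hfe, hμ, map_zero]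
      ring
    rw [hval] at hc
    rwa [Submodule.sub_mem_iff_left _ (I.mul_mem_left _ hb),
      Submodule.sub_mem_iff_left _ (I.mul_mem_left _ hx)] at hc
  have hI : (1 : S) ∉ I := I.one_notMem
  rcases Ideal.IsPrime.mem_or_mem ‹_› hx with ha | ha
  · refine hI ?_
    have := I.sub_mem h1 (I.mul_mem_right (1 - x) ha)
    ring_nf at this
    exact this
  · have ha' : h f e' ∈ I := (Ideal.add_mem_iff_left _ ha).mp h1
    refine hI ?_
    have := I.add_mem ha (I.mul_mem_right x ha')
    ring_nf at this
    exact this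

/-- The case where `h e e'` vanishes at `n` but not at `σ n`. -/
theorem exists_isotropicValue_of_mem_of_notMem (hσ : ∀ s : S, σ (σ s) = s) (hfe : h f' e' = 1)
    (n : Ideal S) [n.IsMaximal] {s₀ : S} (hs₀ : s₀ - σ s₀ ∉ n) (hb : h e e' ∈ n)
    (hb' : σ (h e e') ∉ n) :
    ∃ v s, isotropicValue h t e f e' v s ∉ n ∧ σ (isotropicValue h t e f e' v s) ∉ n := by
  obtain ⟨v, hv⟩ : ∃ v, h f e' + h (pairProj h e f v) e' ∉ n := by
    by_cases ha : h f e' ∈ n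
    · refine ⟨f', fun hc => n.one_notMem ?_⟩
      rw [pairProj_left, hfe] at hc
      have : (1 : S) = (h f e' + (1 - σ (h f f') * h e e' - σ (h e f') * h f e'))
          + σ (h f f') * h e e' - (1 - σ (h e f')) * h f e' := by ring
      rw [this]
      exact n.sub_mem (n.add_mem hc (n.mul_mem_left _ hb)) (n.mul_mem_left _ ha)
    · exact ⟨0, by simpa using ha⟩
  have h1 : ∀ s, isotropicValue h t e f e' v s ∉ n := fun s hc => hv <| by
    rwa [isotropicValue, Submodule.sub_mem_iff_left _ (n.mul_mem_left _ hb)] at hc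
  have h2 : ∀ s, σ (isotropicValue h t e f e' v s) =
      σ (isotropicValue h t e f e' v 0) - (s - σ s) * σ (h e e') := by
    intro s
    simp only [isotropicValue, map_sub, map_add, map_mul, hσ, map_zero]
    ring
  -- modulo `n` the value does not depend on `s`, and its conjugate does
  by_cases h0 : σ (isotropicValue h t e f e' v 0) ∈ n
  · refine ⟨v, s₀, h1 _, fun hc => ?_⟩
    rw [h2, Submodule.sub_mem_iff_right _ h0] at hc
    exact (Ideal.IsPrime.mem_or_mem inferInstance hc).elim hs₀ hb'
  · exact ⟨v, 0, h1 _, h0⟩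

/-- Modulo every maximal ideal `n ∩ R` of `R`, the value `h z e'` can be made a unit: it can be made
to avoid both `n` and `σ n`. -/
theorem exists_isotropicValue_notMem (hσ : ∀ s : S, σ (σ s) = s) (hh : ∀ x y, h x y = σ (h y x))
    (hp : IsHyperbolicPair h e f) (he' : h e' e' = 0) (hfe : h f' e' = 1) (ht : t + σ t = 1)
    (n : Ideal S) [hn : n.IsMaximal] {s₀ : S} (hs₀ : s₀ - σ s₀ ∉ n) :
    ∃ v s, isotropicValue h t e f e' v s ∉ n ∧ σ (isotropicValue h t e f e' v s) ∉ n := by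
  let n' : Ideal S := n.comap σ
  have hn' : n'.IsMaximal := Ideal.comap_isMaximal_of_equiv σ
  have hmem : ∀ s, s ∈ n' ↔ σ s ∈ n := fun s => Iff.rfl
  have hs₀' : s₀ - σ s₀ ∉ n' := by
    rwa [hmem, map_sub, hσ, ← neg_mem_iff, neg_sub]
  by_cases hb : h e e' ∈ n <;> by_cases hb' : σ (h e e') ∈ n
  · obtain ⟨x, hx, hx'⟩ := exists_quasi_inverse hσ n (h f e')
    refine ⟨σ (1 - h f e' * x) • f', 0, ?_, ?_⟩
    · exact isotropicValue_notMem hfe n hb x _ (hσ _) hx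
    · exact isotropicValue_notMem hfe n' hb' x _ (hσ _) hx'
  · exact exists_isotropicValue_of_mem_of_notMem hσ hfe n hs₀ hb hb'
  · obtain ⟨v, s, h1, h2⟩ := exists_isotropicValue_of_mem_of_notMem (f := f) (t := t) hσ hfe n'
      hs₀' hb' (by rwa [hmem, hσ])
    rw [hmem] at h1 h2
    exact ⟨v, s, by rwa [hσ] at h2, h1⟩
  · obtain ⟨x, hx, hx'⟩ := exists_quasi_inverse hσ n (h e e')
    have hx1 := (hn.isPrime.mem_or_mem hx).resolve_left hb
    rw [map_mul] at hx'
    have hx2 := (hn.isPrime.mem_or_mem hx').resolve_left hb'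
    have hm := isotropicValue_sub_mem hσ hh hp he' ht s₀ x n hx1 hx2
    have hm' := isotropicValue_sub_mem hσ hh hp he' ht s₀ x n' hx2 (by rwa [hmem, hσ])
    have key : ∀ c, c - (s₀ - σ s₀) * h e e' ∈ n → c - (s₀ - σ s₀) * h e e' ∈ n' →
        c ∉ n ∧ σ c ∉ n := fun c hc hc' =>
      ⟨fun h0 => (hn.isPrime.mem_or_mem ((Submodule.sub_mem_iff_right _ h0).mp hc)).elim hs₀ hb,
        fun h0 => (hn'.isPrime.mem_or_mem
          ((Submodule.sub_mem_iff_right n' h0).mp hc')).elim hs₀' hb'⟩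
    exact ⟨_, _, key _ hm hm'⟩

end Local

end Transitivity

/-! ### Cancellation of a hyperbolic plane -/

section Cancellation

variable {R S : Type*} [CommRing R] [CommRing S] [Algebra R S] {σ : S ≃ₐ[R] S}
  {V : Type*} [AddCommGroup V] [Module S V]

theorem exists_generators_over_base (R : Type*) {S : Type*} [CommRing R] [CommRing S]
    [Algebra R S] [Module.Finite R S] (V : Type*) [AddCommGroup V] [Module S V]
    [Module.Finite S V] :
    ∃ (N : ℕ) (v : Fin N → V), ∀ y : V, ∃ x : Fin N → R, ∑ i, algebraMap R S (x i) • v i = y := by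
  let : Module R V := Module.compHom V (algebraMap R S)
  have : IsScalarTower R S V := IsScalarTower.of_algebraMap_smul fun _ _ => rfl
  have : Module.Finite R V := Module.Finite.trans S V
  obtain ⟨N, v, hv⟩ := Module.Finite.exists_fin (R := R) (M := V)
  refine ⟨N, v, fun y => ?_⟩
  have hy : y ∈ Submodule.span R (Set.range v) := hv ▸ Submodule.mem_top
  obtain ⟨x, hx⟩ := (Submodule.mem_span_range_iff_exists_fun R).mp hy
  exact ⟨x, by simpa only [algebraMap_smul] using hx⟩

/-- `isotropicValue` is a polynomial in coordinates of `v` and `s` over `R`, so that the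
local-global principle applies to it. -/
theorem IsLGRing.exists_isUnit_isotropicValue (hR : IsLGRing R) (hS : IsQuadraticEtale R S)
    (hσ : IsStandardInvolution σ) [Module.Finite S V] {h : SesqForm σ V}
    (hh : ∀ x y, h x y = σ (h y x)) {e f e' f' : V} (hp : IsHyperbolicPair h e f)
    (he' : h e' e' = 0) (hfe : h f' e' = 1) {t : S} (ht : t + σ t = 1) :
    ∃ v s, IsUnit (isotropicValue h t e f e' v s) := by
  have := hS.finite
  obtain ⟨p, v, hv⟩ := exists_generators_over_base R (S := S) V
  obtain ⟨q, g, hg⟩ := exists_generators_over_base R (S := S) S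
  let F : MvPolynomial (Fin p ⊕ Fin q) S :=
    .C (h f e') + ∑ i, .X (.inl i) * .C (h (pairProj h e f (v i)) e') -
      (.C (σ t) * (∑ i, ∑ j, .X (.inl i) * .X (.inl j) *
        .C (h (pairProj h e f (v i)) (pairProj h e f (v j)))) +
        ∑ j, .X (.inr j) * .C (σ (g j) - g j)) * .C (h e e')
  have hF : ∀ x : Fin p ⊕ Fin q → R, MvPolynomial.eval (fun i => algebraMap R S (x i)) F =
      isotropicValue h t e f e' (∑ i, algebraMap R S (x (.inl i)) • v i)
        (∑ j, algebraMap R S (x (.inr j)) • g j) := by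
    intro x
    have h₁ : h (pairProj h e f (∑ i, algebraMap R S (x (.inl i)) • v i)) e' =
        ∑ i, algebraMap R S (x (.inl i)) * h (pairProj h e f (v i)) e' := by
      simp [Algebra.smul_def]
    have h₂ : h (pairProj h e f (∑ i, algebraMap R S (x (.inl i)) • v i))
          (pairProj h e f (∑ i, algebraMap R S (x (.inl i)) • v i)) =
        ∑ i, ∑ j, algebraMap R S (x (.inl i)) * algebraMap R S (x (.inl j)) *
          h (pairProj h e f (v i)) (pairProj h e f (v j)) := by
      rw [Finset.sum_comm]
      simp [Algebra.smul_def, Finset.mul_sum, mul_assoc, mul_left_comm]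
    have h₃ : σ (∑ j, algebraMap R S (x (.inr j)) • g j) -
        ∑ j, algebraMap R S (x (.inr j)) • g j =
          ∑ j, algebraMap R S (x (.inr j)) * (σ (g j) - g j) := by
      simp [mul_sub]
    rw [isotropicValue, add_sub_assoc (σ t * _), h₁, h₂, h₃]
    simp [F]
  obtain ⟨x, hx⟩ := hR.exists_isUnit_eval hS hσ F fun n hn => by
    obtain ⟨s₀, hs₀⟩ := hS.exists_sub_notMem hσ n
    obtain ⟨w, s, h1, h2⟩ := exists_isotropicValue_notMem hσ.involutive hh hp he' hfe ht n hs₀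
    obtain ⟨x, rfl⟩ := hv w
    obtain ⟨y, rfl⟩ := hg s
    exact ⟨Sum.elim x y, by rw [hF]; exact h1, by rw [hF]; exact h2⟩
  exact ⟨_, _, hF x ▸ hx⟩

/-- The isometry group acts transitively on the vectors `e` which extend to a hyperbolic pair: two
of them are connected by two quasi-reflections through an isotropic vector `z` such that `h e z`
and `h z e'` are units. -/
theorem IsHyperbolicPair.exists_isometry (hR : IsLGRing R) (hS : IsQuadraticEtale R S)
    (hσ : IsStandardInvolution σ) [Module.Finite S V] {h : SesqForm σ V}
    (hh : ∀ x y, h x y = σ (h y x)) {e f e' f' : V} (hp : IsHyperbolicPair h e f)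
    (hp' : IsHyperbolicPair h e' f') :
    ∃ g : V ≃ₗ[S] V, (∀ u v, h (g u) (g v) = h u v) ∧ g e = e' := by
  obtain ⟨t, ht⟩ := hS.exists_trace_eq_one hσ
  obtain ⟨v, s, hu⟩ := hR.exists_isUnit_isotropicValue hS hσ hh hp hp'.left_self hp'.right_left ht
  set w := pairProj h e f v with hw
  let q := t * h w w + s - σ s
  let z := f + w - q • e
  have hew : h e w = 0 := hp.left_pairProj v
  have hfw : h f w = 0 := hp.right_pairProj v
  have hez : h e z = 1 := by simp [z, hp.left_right, hew, hp.left_self]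
  have hze : h z e = 1 := by rw [hh, hez, map_one]
  have hzz : h z z = 0 := by
    have hwf : h w f = 0 := by rw [hh, hfw, map_zero]
    have hq : q + σ q = h w w := by
      simp only [q, map_sub, map_add, map_mul, hσ.involutive, ← hh w w]
      linear_combination h w w * ht
    have hzw : h z w = h w w := by simp [z, hew, hfw]
    have hzf : h z f = -σ q := by simp [z, hp.right_self, hp.left_right, hwf]
    calc h z z = h z f + h z w - q * h z e := by
          conv_lhs => rw [show h z z = h z (f + w - q • e) from rfl]
          simp
      _ = 0 := by rw [hzw, hzf, hze, ← hq]; ring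
  have hzv : h z e' = isotropicValue h t e f e' v s := by
    simp only [z, q, isotropicValue, ← hw, map_sub, map_add, map_smulₛₗ, LinearMap.sub_apply,
      LinearMap.add_apply, LinearMap.smul_apply, smul_eq_mul, RingHom.coe_coe, map_mul,
      hσ.involutive, ← hh w w]
  obtain ⟨g₁, hg₁, hg₁e⟩ := exists_isometry_apply_eq hh (x := e) (y := z)
    (by rw [hp.left_self, hzz]) (by simp [hp.left_self, hze])
  obtain ⟨g₂, hg₂, hg₂z⟩ := exists_isometry_apply_eq hh (x := z) (y := e')
    (by rw [hp'.left_self, hzz]) (by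
      rw [LinearMap.map_sub h, LinearMap.sub_apply, hzz, zero_sub, IsUnit.neg_iff, hh, hzv]
      exact hu.map σ)
  exact ⟨g₁.trans g₂, fun u v => by simp [hg₁, hg₂], by simp [hg₁e, hg₂z]⟩

/-- Cancellation of a hyperbolic plane. -/
theorem IsHyperbolicPair.isIsometric_compl (hR : IsLGRing R) (hS : IsQuadraticEtale R S)
    (hσ : IsStandardInvolution σ) [Module.Finite S V] {h : SesqForm σ V}
    (hh : ∀ x y, h x y = σ (h y x)) {e f e' f' : V} (hp : IsHyperbolicPair h e f)
    (hp' : IsHyperbolicPair h e' f') :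
    IsIsometric (restrictForm h (pairCompl h e f)) (restrictForm h (pairCompl h e' f')) := by
  obtain ⟨g, hg, rfl⟩ := hp.exists_isometry hR hS hσ hh hp'
  have hgp : IsHyperbolicPair h (g e) (g f) :=
    ⟨by rw [hg, hp.left_self], by rw [hg, hp.right_self], by rw [hg, hp.left_right],
      by rw [hg, hp.right_left]⟩
  exact (isIsometric_restrictForm_of_isometry g hg fun x => by simp [mem_pairCompl, hg]).trans
    (hgp.isIsometric_compl_of_left hh hp')

end Cancellation

/-! ### Cancellation of several hyperbolic planes -/

section Families

variable {R S : Type*} [CommRing R] [CommRing S] [Algebra R S] {σ : S ≃ₐ[R] S}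

/-- The standard basis of an orthogonal sum of `n` hyperbolic planes. -/
structure IsHyperbolicFamily {V : Type*} [AddCommGroup V] [Module S V] (h : SesqForm σ V) {n : ℕ}
    (e f : Fin n → V) : Prop where
  left_left : ∀ i j, h (e i) (e j) = 0
  right_right : ∀ i j, h (f i) (f j) = 0
  left_right : ∀ i j, h (e i) (f j) = if i = j then 1 else 0
  right_left : ∀ i j, h (f i) (e j) = if i = j then 1 else 0

/-- The orthogonal complement of two families of vectors. -/
def familyCompl {V : Type*} [AddCommGroup V] [Module S V] (h : SesqForm σ V) {n : ℕ}
    (e f : Fin n → V) : Submodule S V :=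
  ⨅ i, pairCompl h (e i) (f i)

variable {V V₁ V₂ : Type*} [AddCommGroup V] [Module S V] [AddCommGroup V₁] [Module S V₁]
  [AddCommGroup V₂] [Module S V₂]

theorem mem_familyCompl {h : SesqForm σ V} {n : ℕ} {e f : Fin n → V} {v : V} :
    v ∈ familyCompl h e f ↔ ∀ i, h (e i) v = 0 ∧ h (f i) v = 0 := by
  simp [familyCompl, mem_pairCompl]

theorem IsHyperbolicFamily.pair {h : SesqForm σ V} {n : ℕ} {e f : Fin n → V}
    (H : IsHyperbolicFamily h e f) (i : Fin n) : IsHyperbolicPair h (e i) (f i) :=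
  ⟨H.left_left i i, H.right_right i i, by simp [H.left_right], by simp [H.right_left]⟩

theorem IsHyperbolicFamily.map {h₁ : SesqForm σ V₁} {h₂ : SesqForm σ V₂} {n : ℕ}
    {e f : Fin n → V₁} (H : IsHyperbolicFamily h₁ e f) {g : V₁ → V₂}
    (hg : ∀ u v, h₂ (g u) (g v) = h₁ u v) :
    IsHyperbolicFamily h₂ (fun i => g (e i)) (fun i => g (f i)) := by
  constructor <;> intro i j <;> simp only [hg]
  exacts [H.left_left i j, H.right_right i j, H.left_right i j, H.right_left i j]

theorem IsHyperbolicFamily.tail_mem {h : SesqForm σ V} {n : ℕ} {e f : Fin (n + 1) → V}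
    (H : IsHyperbolicFamily h e f) (i : Fin n) :
    e i.succ ∈ pairCompl h (e 0) (f 0) ∧ f i.succ ∈ pairCompl h (e 0) (f 0) := by
  simp [mem_pairCompl, H.left_left, H.right_right, H.left_right, H.right_left,
    (Fin.succ_ne_zero i).symm]

/-- The projection onto the complement of a hyperbolic pair, as a map to the complement. -/
def IsHyperbolicPair.projCompl {h : SesqForm σ V} {e f : V} (hp : IsHyperbolicPair h e f) :
    V →ₗ[S] pairCompl h e f :=
  (pairProj h e f).codRestrict _ fun v =>
    mem_pairCompl.mpr ⟨hp.left_pairProj v, hp.right_pairProj v⟩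

theorem IsHyperbolicPair.projCompl_apply {h : SesqForm σ V} {e f : V}
    (hp : IsHyperbolicPair h e f) {v : V} (hv : v ∈ pairCompl h e f) :
    (hp.projCompl v : V) = v := by
  rw [mem_pairCompl] at hv
  simp [projCompl, pairProj_apply, hv.1, hv.2]

theorem IsHyperbolicPair.finite_pairCompl [Module.Finite S V] {h : SesqForm σ V} {e f : V}
    (hp : IsHyperbolicPair h e f) : Module.Finite S (pairCompl h e f) :=
  Module.Finite.of_surjective hp.projCompl fun v =>
    ⟨v, Subtype.ext (hp.projCompl_apply v.2)⟩

theorem IsHyperbolicFamily.isIsometric_compl_tail {h : SesqForm σ V} {n : ℕ}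
    {e f : Fin (n + 1) → V} (H : IsHyperbolicFamily h e f) :
    IsIsometric (restrictForm h (familyCompl h e f))
      (restrictForm (restrictForm h (pairCompl h (e 0) (f 0)))
        (familyCompl (restrictForm h (pairCompl h (e 0) (f 0)))
          (fun i : Fin n => ⟨e i.succ, (H.tail_mem i).1⟩)
          (fun i : Fin n => ⟨f i.succ, (H.tail_mem i).2⟩))) := by
  have hmem : ∀ x ∈ familyCompl h e f, x ∈ pairCompl h (e 0) (f 0) := fun x hx =>
    mem_pairCompl.mpr (mem_familyCompl.mp hx 0)
  have hval : ∀ x ∈ familyCompl h e f, ((H.pair 0).projCompl x : V) = x := fun x hx =>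
    (H.pair 0).projCompl_apply (hmem x hx)
  refine isIsometric_restrictForm (H.pair 0).projCompl (Submodule.subtype _) ?_ ?_ ?_ ?_ ?_
  · intro x hx
    rw [mem_familyCompl]
    intro i
    simpa [hval x hx] using mem_familyCompl.mp hx i.succ
  · intro y hy
    rw [mem_familyCompl] at hy ⊢
    exact fun i => Fin.cases (mem_pairCompl.mp y.2) hy i
  · exact fun x hx => hval x hx
  · exact fun y _ => Subtype.ext ((H.pair 0).projCompl_apply y.2)
  · intro x hx y hy
    rw [restrictForm_apply, hval x hx, hval y hy]

/-- Cancellation of `n` hyperbolic planes. -/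
theorem IsHyperbolicFamily.isIsometric_compl (hR : IsLGRing R) (hS : IsQuadraticEtale R S)
    (hσ : IsStandardInvolution σ) {V : Type*} [AddCommGroup V] [Module S V] [Module.Finite S V]
    {h : SesqForm σ V} (hh : ∀ x y, h x y = σ (h y x)) {n : ℕ} {e f e' f' : Fin n → V}
    (H : IsHyperbolicFamily h e f) (H' : IsHyperbolicFamily h e' f') :
    IsIsometric (restrictForm h (familyCompl h e f)) (restrictForm h (familyCompl h e' f')) := by
  induction n generalizing V with
  | zero =>
    exact isIsometric_restrictForm_of_isometry (LinearEquiv.refl S V) (fun _ _ => rfl)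
      fun x => by simp [mem_familyCompl]
  | succ n ih =>
    obtain ⟨g, hg⟩ := (H.pair 0).isIsometric_compl hR hS hσ hh (H'.pair 0)
    have := (H'.pair 0).finite_pairCompl
    have T : IsHyperbolicFamily (restrictForm h (pairCompl h (e 0) (f 0)))
        (fun i : Fin n => ⟨e i.succ, (H.tail_mem i).1⟩)
        (fun i : Fin n => ⟨f i.succ, (H.tail_mem i).2⟩) := by
      constructor <;> intro i j <;>
        simp [H.left_left, H.right_right, H.left_right, H.right_left]
    have T' : IsHyperbolicFamily (restrictForm h (pairCompl h (e' 0) (f' 0)))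
        (fun i : Fin n => ⟨e' i.succ, (H'.tail_mem i).1⟩)
        (fun i : Fin n => ⟨f' i.succ, (H'.tail_mem i).2⟩) := by
      constructor <;> intro i j <;>
        simp [H'.left_left, H'.right_right, H'.left_right, H'.right_left]
    refine H.isIsometric_compl_tail.trans (.trans ?_ H'.isIsometric_compl_tail.symm)
    refine .trans ?_ (ih (h := restrictForm h (pairCompl h (e' 0) (f' 0))) (fun x y => hh x y)
       (T.map hg) T')
    exact isIsometric_restrictForm_of_isometry g hg fun x => by
      simp only [mem_familyCompl, hg]

end Families

/-! ### Complements in hyperbolic spaces -/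

section Complement

variable {R S : Type*} [CommRing R] [CommRing S] [Algebra R S] {σ : S ≃ₐ[R] S}

/-- The hyperbolic form on `Sⁿ × Sⁿ`. -/
def hyperbolicForm (σ : S ≃ₐ[R] S) (n : ℕ) : SesqForm σ ((Fin n → S) × (Fin n → S)) :=
  LinearMap.mk₂'ₛₗ (σ : S →+* S) (RingHom.id S)
    (fun x y => ∑ i, σ (x.1 i) * y.2 i + ∑ i, σ (x.2 i) * y.1 i)
    (fun x x' y => by simp [add_mul, Finset.sum_add_distrib]; ring)
    (fun c x y => by simp [mul_add, Finset.mul_sum, mul_assoc])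
    (fun x y y' => by simp [mul_add, Finset.sum_add_distrib]; ring)
    (fun c x y => by simp [mul_add, Finset.mul_sum, mul_left_comm])

theorem hyperbolicForm_apply (n : ℕ) (x y : (Fin n → S) × (Fin n → S)) :
    hyperbolicForm σ n x y = ∑ i, σ (x.1 i) * y.2 i + ∑ i, σ (x.2 i) * y.1 i := rfl

theorem hyperbolicForm_hermitian (hσ : ∀ s : S, σ (σ s) = s) (n : ℕ)
    (x y : (Fin n → S) × (Fin n → S)) :
    hyperbolicForm σ n x y = σ (hyperbolicForm σ n y x) := by
  simp [hyperbolicForm_apply, hσ, mul_comm, add_comm]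

theorem hyperbolicForm_left (n : ℕ) (i : Fin n) (y : (Fin n → S) × (Fin n → S)) :
    hyperbolicForm σ n (Pi.single i 1, 0) y = y.2 i := by
  simp [hyperbolicForm_apply, Pi.single_apply, apply_ite σ]

theorem hyperbolicForm_right (n : ℕ) (i : Fin n) (y : (Fin n → S) × (Fin n → S)) :
    hyperbolicForm σ n (0, Pi.single i 1) y = y.1 i := by
  simp [hyperbolicForm_apply, Pi.single_apply, apply_ite σ]

theorem isHyperbolicFamily_hyperbolicForm (n : ℕ) :
    IsHyperbolicFamily (hyperbolicForm σ n) (fun i => (Pi.single i 1, 0))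
      (fun i => (0, Pi.single i 1)) := by
  constructor <;> intro i j <;>
    simp [hyperbolicForm_left, hyperbolicForm_right, Pi.single_apply]

variable {M : Type*} [AddCommGroup M] [Module S M]

/-- A hermitian space embeds isometrically into a hyperbolic space: if `M` is a direct summand of
`Sⁿ` with projection `p`, send `x` to `(x, θ x)` where `θ x` represents `t * h (p ·) x`. -/
theorem IsHermitianSpace.exists_isometric_embedding (hσ : ∀ s : S, σ (σ s) = s)
    {h : SesqForm σ M} (H : IsHermitianSpace h) {t : S} (ht : t + σ t = 1) :
    ∃ (n : ℕ) (j : M →ₗ[S] (Fin n → S) × (Fin n → S)),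
      ∀ x y, hyperbolicForm σ n (j x) (j y) = h x y := by
  have := H.finite
  have := H.projective
  obtain ⟨n, p, i, -, -, hpi⟩ := Module.Finite.exists_comp_eq_id_of_projective S M
  let θ : M →ₗ[S] Fin n → S := LinearMap.pi fun k => t • h (p (Pi.single k 1))
  have hθ : ∀ (u : Fin n → S) (y : M), ∑ k, σ (u k) * θ y k = t * h (p u) y := by
    intro u y
    conv_rhs => rw [pi_eq_sum_univ' u]
    simp only [map_sum, map_smul, map_smulₛₗ, LinearMap.sum_apply, LinearMap.smul_apply,
      smul_eq_mul, RingHom.coe_coe, Finset.mul_sum, θ, LinearMap.pi_apply]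
    refine Finset.sum_congr rfl fun k _ => ?_
    ring
  have hp : ∀ x, p (i x) = x := LinearMap.congr_fun hpi
  refine ⟨n, i.prod θ, fun x y => ?_⟩
  have h2 : ∑ k, σ (θ x k) * i y k = σ (t * h y x) := by
    rw [← hp y, ← hθ, map_sum, hp]
    exact Finset.sum_congr rfl fun k _ => by rw [map_mul, hσ, mul_comm]
  rw [hyperbolicForm_apply, LinearMap.prod_apply, LinearMap.prod_apply]
  change ∑ k, σ (i x k) * θ y k + ∑ k, σ (θ x k) * i y k = _
  rw [hθ, hp, h2, map_mul, ← H.hermitian x y, ← add_mul, ht, one_mul]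

/-- Every hermitian space `M` has an orthogonal complement `K` in a hyperbolic space. The latter is
recorded by a hyperbolic family in `M × K` with zero complement. -/
theorem IsHermitianSpace.exists_orthSum_hyperbolic (hσ : ∀ s : S, σ (σ s) = s)
    {h : SesqForm σ M} (H : IsHermitianSpace h) {t : S} (ht : t + σ t = 1) :
    ∃ (n : ℕ) (K : Submodule S ((Fin n → S) × (Fin n → S))) (k : SesqForm σ K)
      (e f : Fin n → M × K), Module.Finite S K ∧ (∀ x y, k x y = σ (k y x)) ∧
        IsHyperbolicFamily (orthSum h k) e f ∧
        ∀ v, v ∈ familyCompl (orthSum h k) e f → v = 0 := by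
  obtain ⟨n, j, hj⟩ := H.exists_isometric_embedding hσ ht
  set b := hyperbolicForm σ n with hb
  have hbh : ∀ x y, b x y = σ (b y x) := hyperbolicForm_hermitian hσ n
  -- the adjoint of `j`
  choose P₀ hP₀ using fun w => H.regular.2 ((b w).comp j)
  have hP₀' : ∀ w y, h (P₀ w) y = b w (j y) := fun w y => LinearMap.congr_fun (hP₀ w) y
  let P : (Fin n → S) × (Fin n → S) →ₗ[S] M :=
    { toFun := P₀
      map_add' := fun w w' => H.regular.1 <| LinearMap.ext fun y => by simp [hP₀']
      map_smul' := fun c w => H.regular.1 <| LinearMap.ext fun y => by simp [hP₀'] }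
  have hP : ∀ w y, h (P w) y = b w (j y) := hP₀'
  have hP' : ∀ w y, h y (P w) = b (j y) w := fun w y => by rw [H.hermitian, hP, ← hbh]
  have hPj : ∀ y, P (j y) = y := fun y =>
    H.regular.1 <| LinearMap.ext fun x => by rw [hP, hj]
  let K := LinearMap.ker P
  let Q : (Fin n → S) × (Fin n → S) →ₗ[S] K :=
    (LinearMap.id - j ∘ₗ P).codRestrict K fun w => by simp [K, hPj]
  have hQ : ∀ w, (Q w : (Fin n → S) × (Fin n → S)) = w - j (P w) := fun w => rfl
  have hQK : ∀ κ : K, Q κ = κ := fun κ => Subtype.ext <| by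
    rw [hQ, LinearMap.mem_ker.mp κ.2, map_zero, sub_zero]
  let ψ := P.prod Q
  have hψ : ∀ w w', orthSum h (restrictForm b K) (ψ w) (ψ w') = b w w' := by
    intro w w'
    change h (P w) (P w') + b (w - j (P w)) (w' - j (P w')) = _
    simp only [map_sub, LinearMap.sub_apply, hj, ← hP, ← hP']
    ring
  have hψs : Function.Surjective ψ := by
    rintro ⟨y, κ⟩
    have hκ : P κ = 0 := κ.2
    refine ⟨j y + κ, Prod.ext ?_ (Subtype.ext ?_)⟩
    · change P (j y + κ) = y
      rw [map_add, hPj, hκ, add_zero]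
    · change (j y + κ) - j (P (j y + κ)) = (κ : (Fin n → S) × (Fin n → S))
      rw [map_add, hPj, hκ, add_zero, add_sub_cancel_left]
  refine ⟨n, K, restrictForm b K, _, _, Module.Finite.of_surjective Q fun κ => ⟨κ, hQK κ⟩,
    fun x y => hbh x y, (isHyperbolicFamily_hyperbolicForm n).map hψ, fun v hv => ?_⟩
  obtain ⟨w, rfl⟩ := hψs v
  have hw : ∀ i, w.2 i = 0 ∧ w.1 i = 0 := fun i => by
    have hi := mem_familyCompl.mp hv i
    rw [← hyperbolicForm_left (σ := σ), ← hyperbolicForm_right (σ := σ), ← hb, ← hψ, ← hψ]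
    exact hi
  have : w = 0 := Prod.ext (funext fun i => (hw i).2) (funext fun i => (hw i).1)
  rw [this, map_zero]

variable {N K : Type*} [AddCommGroup N] [Module S N] [AddCommGroup K] [Module S K]

theorem isHyperbolicFamily_orthSum (hM : SesqForm σ M) {hN : SesqForm σ N} {k : SesqForm σ K}
    {n : ℕ} {e f : Fin n → N × K} (H : IsHyperbolicFamily (orthSum hN k) e f) :
    IsHyperbolicFamily (orthSum (orthSum hM hN) k) (fun i => ((0, (e i).1), (e i).2))
      (fun i => ((0, (f i).1), (f i).2)) :=
  H.map (g := fun v => ((0, v.1), v.2)) fun u v => by simp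

theorem isIsometric_familyCompl_orthSum (hM : SesqForm σ M) {hN : SesqForm σ N}
    {k : SesqForm σ K} {n : ℕ} {e f : Fin n → N × K}
    (H : ∀ v, v ∈ familyCompl (orthSum hN k) e f → v = 0) :
    IsIsometric hM (restrictForm (orthSum (orthSum hM hN) k)
      (familyCompl (orthSum (orthSum hM hN) k) (fun i => ((0, (e i).1), (e i).2))
        (fun i => ((0, (f i).1), (f i).2)))) := by
  set L := familyCompl (orthSum (orthSum hM hN) k) (fun i => ((0, (e i).1), (e i).2))
        (fun i => ((0, (f i).1), (f i).2)) with hL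
  have hmem : ∀ x : M, ((x, 0), 0) ∈ L := fun x => by simp [hL, mem_familyCompl]
  have hzero : ∀ v ∈ L, v.1.2 = 0 ∧ v.2 = 0 := by
    intro v hv
    have := H (v.1.2, v.2) <| mem_familyCompl.mpr fun i => by
      simpa using mem_familyCompl.mp hv i
    simpa using this
  let ι : M →ₗ[S] L := (LinearMap.inl S (M × N) K ∘ₗ LinearMap.inl S M N).codRestrict L hmem
  have hι : ∀ x, (ι x : (M × N) × K) = ((x, 0), 0) := fun _ => rfl
  refine ⟨LinearEquiv.ofLinearMap ι
    (LinearMap.fst S M N ∘ₗ LinearMap.fst S (M × N) K ∘ₗ L.subtype) ?_ ?_, fun x y => ?_⟩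
  · ext v <;> simp [hι, (hzero v v.2).1, (hzero v v.2).2]
  · ext x
    simp [hι]
  · simp [hι]

end Complement

theorem mainTheorem9 {R S : Type*} [CommRing R] [CommRing S] [Algebra R S]
    (hR : IsLGRing R) (hS : IsQuadraticEtale R S)
    (σ : S ≃ₐ[R] S) (hσ : IsStandardInvolution σ)
    {M₁ M₂ M₃ : Type*} [AddCommGroup M₁] [Module S M₁] [AddCommGroup M₂] [Module S M₂]
    [AddCommGroup M₃] [Module S M₃]
    (h₁ : SesqForm σ M₁) (h₂ : SesqForm σ M₂) (h₃ : SesqForm σ M₃)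
    (hh₁ : IsHermitianSpace h₁) (hh₂ : IsHermitianSpace h₂) (hh₃ : IsHermitianSpace h₃)
    (hiso : IsIsometric (orthSum h₁ h₃) (orthSum h₂ h₃)) :
    IsIsometric h₁ h₂ := by
  obtain ⟨t, ht⟩ := hS.exists_trace_eq_one hσ
  obtain ⟨n, K, k, e, f, hK, hk, H, H0⟩ := hh₃.exists_orthSum_hyperbolic hσ.involutive ht
  obtain ⟨φ, hφ⟩ := hiso
  have := hh₂.finite
  have := hh₃.finite
  let g : ((M₁ × M₃) × K) ≃ₗ[S] (M₂ × M₃) × K := φ.prodCongr (LinearEquiv.refl S K)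
  have hg : ∀ u v, orthSum (orthSum h₂ h₃) k (g u) (g v) = orthSum (orthSum h₁ h₃) k u v := by
    intro u v
    change orthSum h₂ h₃ (φ u.1) (φ v.1) + k u.2 v.2 = _
    rw [hφ]
    rfl
  have hherm : ∀ x y, orthSum (orthSum h₂ h₃) k x y = σ (orthSum (orthSum h₂ h₃) k y x) :=
    orthSum_hermitian (orthSum_hermitian hh₂.hermitian hh₃.hermitian) hk
  refine (isIsometric_familyCompl_orthSum h₁ H0).trans
    (.trans ?_ (isIsometric_familyCompl_orthSum h₂ H0).symm)
  refine .trans ?_ (IsHyperbolicFamily.isIsometric_compl hR hS hσ hherm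
    ((isHyperbolicFamily_orthSum h₁ H).map hg) (isHyperbolicFamily_orthSum h₂ H))
  exact isIsometric_restrictForm_of_isometry g hg fun x => by simp only [mem_familyCompl, hg]
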